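/- Let $\mathbb F$ be an algebraically closed field of characteristic $0$; all Lie algebras and vector spaces below are finite-dimensional over $\mathbb F$. An invariant metric on a Lie algebra $\mathfrak g$ is a symmetric non-degenerate bilinear form $B$ with $B(x,[y,z])=B([x,y],z)$; the pair $(\mathfrak g,B)$ is then called a quadratic Lie algebra. An isometry of quadratic Lie algebras is a Lie algebra isomorphism that preserves the metrics. Double central extensions. Let $(\mathfrak h,B_{\mathfrak h})$ be a quadratic Lie algebra and $\mathfrak a$ a vector space. Let $\phi$ be a linear map from $\mathfrak a$ to the $B_{\mathfrak h}$-skew-symmetric derivations of $\mathfrak h$, and let $\Psi:\mathfrak a\times\mathfrak a\to\mathfrak h$ and $\omega:\mathfrak a\times\mathfrak a\to\mathfrak a^*$ be skew-symmetric bilinear maps. Put $\Phi(x,y)(a)=B_{\mathfrak h}(\phi(a)x,y)$ and $\chi(a,x)(b)=-B_{\mathfrak h}(\Psi(a,b),x)$, and suppose that for all $a,b,c\in\mathfrak a$ $$[\phi(a),\phi(b)]=\operatorname{ad}_{\mathfrak h}\Psi(a,b),\qquad \phi(a)\Psi(b,c)+\phi(b)\Psi(c,a)+\phi(c)\Psi(a,b)=0,$$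 $$\chi(a,\Psi(b,c))+\chi(b,\Psi(c,a))+\chi(c,\Psi(a,b))=0,\qquad \omega(a,b)(c)=\omega(b,c)(a).$$ The double central extension of $(\mathfrak h,B_{\mathfrak h})$ by $\mathfrak a$ defined by these data is the vector space $\mathfrak a\oplus\mathfrak h\oplus\mathfrak a^*$ with the Lie bracket $$[a,b]=\Psi(a,b)+\omega(a,b),\quad [a,x]=\phi(a)x+\chi(a,x),\quad [x,y]=[x,y]_{\mathfrak h}+\Phi(x,y),\quad \mathfrak a^*\text{ central}$$ ($a,b\in\mathfrak a$, $x,y\in\mathfrak h$), and with the invariant metric $B(a+x+\alpha,b+y+\beta)=B_{\mathfrak h}(x,y)+\beta(a)+\alpha(b)$. Its quotient by $\mathfrak a^*$ is the Lie algebra $\mathfrak a\oplus\mathfrak h$ with bracket $[a,b]=\Psi(a,b)$, $[a,x]=\phi(a)x$, $[x,y]=[x,y]_{\mathfrak h}$. Theorem. Let $(\mathfrak g,B_{\mathfrak g})$ be an $n$-dimensional quadratic Lie algebra, $V$ an $r$-dimensional vector space, and $0\to V\to\mathfrak G\xrightarrow{\ \pi\ }\mathfrak g\to0$ a central extension of $\mathfrak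 g$ by $V$. Suppose that $B_{\mathfrak G}$ is an invariant metric on $\mathfrak G$. (i) If $B_{\mathfrak G}|_{V\times V}$ is non-degenerate, then there is an invariant metric $\bar B_{\mathfrak g}$ on $\mathfrak g$ such that $(\mathfrak G,B_{\mathfrak G})$ is isometric to the orthogonal direct sum $(\mathfrak g,\bar B_{\mathfrak g})\perp(V,B_{\mathfrak G}|_{V\times V})$, where $V$ is an abelian Lie algebra. (ii) If $V$ is isotropic, that is, $B_{\mathfrak G}(V,V)=0$, then $r\le\dim C(\mathfrak g)$, where $C(\mathfrak g)$ is the center of $\mathfrak g$, and there are an $r$-dimensional subspace $\mathfrak a$ and an $(n-r)$-dimensional ideal $\mathfrak h$ of $\mathfrak g$ with $\mathfrak g=\mathfrak a\oplus\mathfrak h$ as vector spaces and $[\mathfrak g,\mathfrak g]\subseteq\mathfrak h$, an invariant metric $B_{\mathfrak h}$ on $\mathfrak h$, and data $(\phi,\Psi,\omega)$ as above, such that: - $(\mathfrak G,B_{\mathfrak G})$ is isometric to the double central extension $\mathfrak a\oplus\mathfrak h\oplus\mathfrak a^*$ of $(\mathfrak h,B_{\mathfrak h})$ by $\mathfrak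 a$ defined by these data, by an isometry $\Omega$ that maps $V$ isomorphically onto $\mathfrak a^*$; - the Lie algebra $\mathfrak a\oplus\mathfrak h$ defined by $\phi$ and $\Psi$ carries an invariant metric $B_{\mathfrak a\oplus\mathfrak h}$ for which $a+x\mapsto a+x$ is an isometry from $\mathfrak a\oplus\mathfrak h$ onto $(\mathfrak g,B_{\mathfrak g})$, and under this identification $\Omega$ followed by the projection onto $\mathfrak a\oplus\mathfrak h$ is $\pi$. -/

import Mathlib

open Module

/-- An invariant metric on a Lie algebra: a symmetric non-degenerate bilinear form `B` with
`B ⁅x, y⁆ z = B x ⁅y, z⁆`. A Lie algebra with such a form is a quadratic Lie algebra. -/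
structure IsInvariantMetric {F L : Type*} [Field F] [LieRing L] [LieAlgebra F L]
    (B : LinearMap.BilinForm F L) : Prop where
  symm : ∀ x y, B x y = B y x
  nondegenerate : B.Nondegenerate
  invariant : ∀ x y z, B x ⁅y, z⁆ = B ⁅x, y⁆ z

/-- The data `(φ, Ψ, ω)` from which a double central extension of the quadratic Lie algebra
`(𝔥, B)` by the vector space `𝔞` is built. The condition `chi_cyclic` is the cyclic condition
`χ(a, Ψ(b, c)) + χ(b, Ψ(c, a)) + χ(c, Ψ(a, b)) = 0`, evaluated at `d`, for the map
`χ(a, x)(d) = -B(Ψ(a, d), x)`. -/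
structure DoubleCentralData (F : Type*) [Field F] (𝔞 : Type*) [AddCommGroup 𝔞] [Module F 𝔞]
    {𝔥 : Type*} [LieRing 𝔥] [LieAlgebra F 𝔥] {B : LinearMap.BilinForm F 𝔥}
    (hB : IsInvariantMetric B) where
  /-- the action of `𝔞` on `𝔥` by derivations -/
  φ : 𝔞 →ₗ[F] LieDerivation F 𝔥 𝔥
  /-- the `𝔥`-component of the bracket of two elements of `𝔞` -/
  Ψ : 𝔞 →ₗ[F] 𝔞 →ₗ[F] 𝔥
  /-- the `𝔞*`-component of the bracket of two elements of `𝔞` -/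
  ω : 𝔞 →ₗ[F] 𝔞 →ₗ[F] Dual F 𝔞
  phi_skew : ∀ a x y, B (φ a x) y = -B x (φ a y)
  psi_alt : ∀ a, Ψ a a = 0
  phi_comm : ∀ a b x, φ a (φ b x) - φ b (φ a x) = ⁅Ψ a b, x⁆
  phi_cyclic : ∀ a b c, φ a (Ψ b c) + φ b (Ψ c a) + φ c (Ψ a b) = 0
  chi_cyclic : ∀ a b c d,
    -B (Ψ a d) (Ψ b c) + -B (Ψ b d) (Ψ c a) + -B (Ψ c d) (Ψ a b) = 0
  omega_alt : ∀ a, ω a a = 0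
  omega_cyclic : ∀ a b c, ω a b c = ω b c a

namespace DoubleCentralData

variable {F : Type*} [Field F] {𝔞 : Type*} [AddCommGroup 𝔞] [Module F 𝔞]
  {𝔥 : Type*} [LieRing 𝔥] [LieAlgebra F 𝔥] {B : LinearMap.BilinForm F 𝔥}
  {hB : IsInvariantMetric B} (D : DoubleCentralData F 𝔞 hB)

/-- `Φ(x, y)(a) = B(φ(a)(x), y)`. -/
def Phi (x y : 𝔥) : Dual F 𝔞 where
  toFun a := B (D.φ a x) y
  map_add' a b := by simp
  map_smul' t a := by simp

/-- `χ(a, x)(b) = -B(Ψ(a, b), x)`. -/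
def chi (a : 𝔞) (x : 𝔥) : Dual F 𝔞 where
  toFun b := -B (D.Ψ a b) x
  map_add' b c := by simp; ring
  map_smul' t b := by simp

@[simp] theorem Phi_apply (x y : 𝔥) (a : 𝔞) : D.Phi x y a = B (D.φ a x) y := rfl

@[simp] theorem chi_apply (a : 𝔞) (x : 𝔥) (b : 𝔞) : D.chi a x b = -B (D.Ψ a b) x := rfl

theorem psi_skew (a b : 𝔞) : D.Ψ a b = -D.Ψ b a := by
  have h := D.psi_alt (a + b)
  simp only [map_add, LinearMap.add_apply, D.psi_alt, zero_add, add_zero] at h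
  exact eq_neg_of_add_eq_zero_right h

/-- The Lie algebra `𝔞 ⊕ 𝔥` with `[a, b] = Ψ(a, b)`, `[a, x] = φ(a)(x)`, `[x, y] = [x, y]_𝔥`. -/
@[ext] structure Base (D : DoubleCentralData F 𝔞 hB) where
  /-- the component in `𝔞` -/
  a : 𝔞
  /-- the component in `𝔥` -/
  x : 𝔥

/-- The double central extension: the Lie algebra `𝔞 ⊕ 𝔥 ⊕ 𝔞*` with
`[a, b] = Ψ(a, b) + ω(a, b)`, `[a, x] = φ(a)(x) + χ(a, x)`, `[x, y] = [x, y]_𝔥 + Φ(x, y)`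
and `𝔞*` central. -/
@[ext] structure Total (D : DoubleCentralData F 𝔞 hB) where
  /-- the component in `𝔞` -/
  a : 𝔞
  /-- the component in `𝔥` -/
  x : 𝔥
  /-- the component in `𝔞*` -/
  α : Dual F 𝔞

namespace Base

variable {D}

/-- The underlying vector space is `𝔞 × 𝔥`. -/
def equivProd : D.Base ≃ 𝔞 × 𝔥 where
  toFun p := (p.a, p.x)
  invFun p := ⟨p.1, p.2⟩

instance : AddCommGroup D.Base := equivProd.addCommGroup
instance : Module F D.Base := equivProd.module F

@[simp] theorem a_zero : (0 : D.Base).a = 0 := rfl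
@[simp] theorem x_zero : (0 : D.Base).x = 0 := rfl
@[simp] theorem a_add (p q : D.Base) : (p + q).a = p.a + q.a := rfl
@[simp] theorem x_add (p q : D.Base) : (p + q).x = p.x + q.x := rfl
@[simp] theorem a_smul (t : F) (p : D.Base) : (t • p).a = t • p.a := rfl
@[simp] theorem x_smul (t : F) (p : D.Base) : (t • p).x = t • p.x := rfl

instance : Bracket D.Base D.Base where
  bracket p q := ⟨0, ⁅p.x, q.x⁆ + D.φ p.a q.x - D.φ q.a p.x + D.Ψ p.a q.a⟩

@[simp] theorem a_lie (p q : D.Base) : ⁅p, q⁆.a = 0 := rfl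
@[simp] theorem x_lie (p q : D.Base) :
    ⁅p, q⁆.x = ⁅p.x, q.x⁆ + D.φ p.a q.x - D.φ q.a p.x + D.Ψ p.a q.a := rfl

end Base

namespace Total

variable {D}

/-- The underlying vector space is `𝔞 × 𝔥 × 𝔞*`. -/
def equivProd : D.Total ≃ 𝔞 × 𝔥 × Dual F 𝔞 where
  toFun p := (p.a, p.x, p.α)
  invFun p := ⟨p.1, p.2.1, p.2.2⟩

instance : AddCommGroup D.Total := equivProd.addCommGroup
instance : Module F D.Total := equivProd.module F

@[simp] theorem a_zero : (0 : D.Total).a = 0 := rfl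
@[simp] theorem x_zero : (0 : D.Total).x = 0 := rfl
@[simp] theorem α_zero : (0 : D.Total).α = 0 := rfl
@[simp] theorem a_add (p q : D.Total) : (p + q).a = p.a + q.a := rfl
@[simp] theorem x_add (p q : D.Total) : (p + q).x = p.x + q.x := rfl
@[simp] theorem α_add (p q : D.Total) : (p + q).α = p.α + q.α := rfl
@[simp] theorem a_smul (t : F) (p : D.Total) : (t • p).a = t • p.a := rfl
@[simp] theorem x_smul (t : F) (p : D.Total) : (t • p).x = t • p.x := rfl
@[simp] theorem α_smul (t : F) (p : D.Total) : (t • p).α = t • p.α := rfl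

instance : Bracket D.Total D.Total where
  bracket p q :=
    ⟨0, ⁅p.x, q.x⁆ + D.φ p.a q.x - D.φ q.a p.x + D.Ψ p.a q.a,
      D.Phi p.x q.x + D.chi p.a q.x - D.chi q.a p.x + D.ω p.a q.a⟩

@[simp] theorem a_lie (p q : D.Total) : ⁅p, q⁆.a = 0 := rfl
@[simp] theorem x_lie (p q : D.Total) :
    ⁅p, q⁆.x = ⁅p.x, q.x⁆ + D.φ p.a q.x - D.φ q.a p.x + D.Ψ p.a q.a := rfl
@[simp] theorem α_lie (p q : D.Total) :
    ⁅p, q⁆.α = D.Phi p.x q.x + D.chi p.a q.x - D.chi q.a p.x + D.ω p.a q.a := rfl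

end Total

/-- The `𝔥`-component of the Jacobi identity. -/
theorem jacobi_x (a b c : 𝔞) (x y z : 𝔥) :
    ⁅x, ⁅y, z⁆ + D.φ b z - D.φ c y + D.Ψ b c⁆ + D.φ a (⁅y, z⁆ + D.φ b z - D.φ c y + D.Ψ b c) =
      (⁅⁅x, y⁆ + D.φ a y - D.φ b x + D.Ψ a b, z⁆ - D.φ c (⁅x, y⁆ + D.φ a y - D.φ b x + D.Ψ a b)) +
      (⁅y, ⁅x, z⁆ + D.φ a z - D.φ c x + D.Ψ a c⁆ +
        D.φ b (⁅x, z⁆ + D.φ a z - D.φ c x + D.Ψ a c)) := by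
  have h1 := D.phi_comm a b z
  have h2 := D.phi_comm a c y
  have h3 := D.phi_comm b c x
  have h4 := D.phi_cyclic a b c
  rw [D.psi_skew c a, map_neg] at h4
  rw [← lie_skew] at h2 h3
  have h5 := leibniz_lie x y z
  have h6 := lie_skew (D.φ c x) y
  simp only [map_add, map_sub, lie_add, lie_sub, add_lie, sub_lie, LieDerivation.apply_lie_eq_add]
  linear_combination (norm := abel) h1 - h2 + h3 + h4 + h5 - h6

/-- The `𝔞*`-component of the Jacobi identity. -/
theorem jacobi_α (a b c : 𝔞) (x y z : 𝔥) :
    D.Phi x (⁅y, z⁆ + D.φ b z - D.φ c y + D.Ψ b c) +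
        D.chi a (⁅y, z⁆ + D.φ b z - D.φ c y + D.Ψ b c) =
      (D.Phi (⁅x, y⁆ + D.φ a y - D.φ b x + D.Ψ a b) z -
        D.chi c (⁅x, y⁆ + D.φ a y - D.φ b x + D.Ψ a b)) +
      (D.Phi y (⁅x, z⁆ + D.φ a z - D.φ c x + D.Ψ a c) +
        D.chi b (⁅x, z⁆ + D.φ a z - D.φ c x + D.Ψ a c)) := by
  ext d
  have key (u : 𝔞) (s t : 𝔥) : B (D.Ψ u d) ⁅s, t⁆ = B (D.φ u s) (D.φ d t) -
      B (D.φ d s) (D.φ u t) := by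
    rw [hB.invariant, ← D.phi_comm, map_sub, LinearMap.sub_apply, D.phi_skew u (D.φ d s),
      D.phi_skew d (D.φ u s)]
    ring
  have cyc (u v : 𝔞) (s : 𝔥) : B (D.φ d s) (D.Ψ u v) =
      B (D.Ψ u d) (D.φ v s) - B (D.Ψ v d) (D.φ u s) := by
    have h := D.phi_cyclic u v d
    rw [D.psi_skew d u, map_neg] at h
    have h' := congrArg (fun w => B w s) h
    simp only [map_add, map_neg, LinearMap.add_apply, LinearMap.neg_apply, D.phi_skew,
      map_zero, LinearMap.zero_apply] at h'
    rw [hB.symm (D.φ d s)]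
    linear_combination -h'
  have coc : B (D.φ d x) ⁅y, z⁆ = B (D.φ d ⁅x, y⁆) z + B (D.φ d y) ⁅x, z⁆ := by
    rw [LieDerivation.apply_lie_eq_add, map_add, LinearMap.add_apply, hB.invariant, hB.invariant,
      ← lie_skew x, map_neg, LinearMap.neg_apply]
    ring
  have h := D.chi_cyclic a b c d
  rw [D.psi_skew c a, map_neg] at h
  simp only [LinearMap.add_apply, LinearMap.sub_apply, Phi_apply, chi_apply, map_add, map_sub]
  rw [key, key, key, coc, D.phi_skew d (D.φ a y), D.phi_skew d (D.φ b x), D.phi_skew d (D.Ψ a b),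
    hB.symm (D.Ψ a b) (D.φ d z), cyc, cyc, cyc]
  rw [hB.symm (D.φ c x) (D.φ d y)]
  linear_combination h

namespace Base

variable {D}

instance : LieRing D.Base where
  add_lie p q r := by ext <;> simp; abel
  lie_add p q r := by ext <;> simp; abel
  lie_self p := by ext <;> simp [D.psi_alt]
  leibniz_lie p q r := by
    ext
    · simp
    · simpa using! D.jacobi_x p.a q.a r.a p.x q.x r.x

instance : LieAlgebra F D.Base where
  lie_smul t p q := by ext <;> simp [smul_add, smul_sub]

end Base

theorem Phi_add_left (x y z : 𝔥) : D.Phi (x + y) z = D.Phi x z + D.Phi y z := by ext; simp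

theorem Phi_add_right (x y z : 𝔥) : D.Phi x (y + z) = D.Phi x y + D.Phi x z := by ext; simp

theorem chi_add_left (a b : 𝔞) (x : 𝔥) : D.chi (a + b) x = D.chi a x + D.chi b x := by
  ext; simp; ring

theorem chi_add_right (a : 𝔞) (x y : 𝔥) : D.chi a (x + y) = D.chi a x + D.chi a y := by
  ext; simp; ring

theorem chi_zero_left (x : 𝔥) : D.chi 0 x = 0 := by ext; simp

namespace Total

variable {D} [CharZero F]

instance : LieRing D.Total where
  add_lie p q r := by
    ext1
    · simp
    · simp; abel
    · simp [Phi_add_left, chi_add_left, chi_add_right]; abel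
  lie_add p q r := by
    ext1
    · simp
    · simp; abel
    · simp [Phi_add_right, chi_add_left, chi_add_right]; abel
  lie_self p := by
    ext1
    · simp
    · simp [D.psi_alt]
    · ext d
      have h := D.phi_skew d p.x p.x
      rw [hB.symm p.x] at h
      simpa [D.omega_alt, self_eq_neg] using h
  leibniz_lie p q r := by
    ext1
    · simp
    · simpa using! D.jacobi_x p.a q.a r.a p.x q.x r.x
    · simpa [chi_zero_left] using! D.jacobi_α p.a q.a r.a p.x q.x r.x

instance : LieAlgebra F D.Total where
  lie_smul t p q := by
    ext1
    · simp
    · simp [smul_add, smul_sub]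
    · ext; simp; ring

/-- The projection of `𝔞 ⊕ 𝔥 ⊕ 𝔞*` onto `𝔞 ⊕ 𝔥`, a Lie algebra homomorphism. -/
def proj : D.Total →ₗ⁅F⁆ D.Base where
  toFun p := ⟨p.a, p.x⟩
  map_add' _ _ := rfl
  map_smul' _ _ := rfl
  map_lie' := rfl

/-- `B(a + x + α, b + y + β) = B_𝔥(x, y) + β(a) + α(b)`. -/
def metric : LinearMap.BilinForm F D.Total :=
  LinearMap.mk₂ F (fun p q => B p.x q.x + q.α p.a + p.α q.a)
    (fun p p' q => by simp; ring) (fun t p q => by simp; ring)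
    (fun p q q' => by simp; ring) (fun t p q => by simp; ring)

end Total

end DoubleCentralData

/-!
For an invariant metric the center is orthogonal to the derived algebra, so in `𝔊` every bracket is
orthogonal to `V`. If `V` is non-degenerate, the retraction of `𝔊` onto `V` along the orthogonal
complement of `V` is therefore a homomorphism, and it splits the extension.

If `V` is isotropic, `B_𝔊` induces a pairing of `V` with `𝔤`. The elements of `𝔤` that pair to zero
with `V` form an ideal `𝔥` containing `[𝔤, 𝔤]`, and the pairing of `V` with a complement `𝔞` of `𝔥`
is perfect. Because of this, a linear section `s` of `π` can be corrected by a map `𝔤 → V` so that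
`s 𝔞` becomes isotropic and orthogonal to `s 𝔥`. The isometry onto `𝔞 ⊕ 𝔥 ⊕ 𝔞*` then sends `X` to
`π X` together with the functional `c ↦ B_𝔊 (X, s c)` on `𝔞`. The bound on `r` holds because the
orthogonal complement of `𝔥` in `𝔤` is central.
-/

section InvariantMetric

variable {F L L' : Type*} [Field F] [LieRing L] [LieAlgebra F L] [LieRing L'] [LieAlgebra F L']
  {B : LinearMap.BilinForm F L}

namespace IsInvariantMetric

theorem eq_zero_of_forall_apply_eq_zero (hB : IsInvariantMetric B) {x : L}
    (hx : ∀ y, B x y = 0) : x = 0 :=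
  hB.nondegenerate.1 x hx

theorem apply_lie_eq_zero_of_mem_center (hB : IsInvariantMetric B) {z : L}
    (hz : z ∈ LieAlgebra.center F L) (x y : L) : B z ⁅x, y⁆ = 0 := by
  rw [hB.invariant, ← lie_skew, (LieModule.mem_maxTrivSubmodule F L L z).1 hz x, neg_zero,
    map_zero, LinearMap.zero_apply]

theorem comp_of_apply_lie (hB : IsInvariantMetric B) (s : L' →ₗ[F] L)
    (hlie : ∀ x y z, B (s x) (s ⁅y, z⁆) = B (s x) ⁅s y, s z⁆)
    (hsep : ∀ x, (∀ y, B (s x) (s y) = 0) → x = 0) : IsInvariantMetric (B.comp s s) where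
  symm x y := hB.symm (s x) (s y)
  nondegenerate := ⟨hsep, fun y hy => hsep y fun x => (hB.symm _ _).trans (hy x)⟩
  invariant x y z := by
    simp only [LinearMap.BilinForm.comp_apply]
    rw [hlie, hB.invariant, hB.symm, ← hlie, hB.symm]

theorem comp_lieEquiv (hB : IsInvariantMetric B) (e : L' ≃ₗ⁅F⁆ L) :
    IsInvariantMetric (B.comp (e : L' →ₗ[F] L) (e : L' →ₗ[F] L)) :=
  hB.comp_of_apply_lie _ (fun x y z => congrArg (B (e x)) (e.map_lie y z)) fun x hx =>
    (map_eq_zero_iff e e.injective).1 <| hB.eq_zero_of_forall_apply_eq_zero fun y => by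
      simpa using hx (e.symm y)

theorem orthogonal_le_center (hB : IsInvariantMetric B) {W : Submodule F L}
    (hW : ∀ x y : L, ⁅x, y⁆ ∈ W) : B.orthogonal W ≤ (LieAlgebra.center F L).toSubmodule := by
  intro z hz
  rw [LieSubmodule.mem_toSubmodule, LieModule.mem_maxTrivSubmodule]
  refine fun x => hB.eq_zero_of_forall_apply_eq_zero fun y => ?_
  rw [hB.symm, hB.invariant]
  exact hz _ (hW y x)

theorem finrank_le_finrank_add_finrank_center [FiniteDimensional F L] (hB : IsInvariantMetric B)
    {W : Submodule F L} (hW : ∀ x y : L, ⁅x, y⁆ ∈ W) :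
    finrank F L ≤ finrank F W + finrank F (LieAlgebra.center F L) := by
  have hle : finrank F (B.orthogonal W) ≤ finrank F (LieAlgebra.center F L) :=
    Submodule.finrank_mono (hB.orthogonal_le_center hW)
  rw [LinearMap.BilinForm.finrank_orthogonal hB.nondegenerate] at hle
  omega

end IsInvariantMetric

/-- The action of a Lie algebra on one of its ideals, by derivations of that ideal. -/
def adOnIdeal (I : LieIdeal F L) : L →ₗ[F] LieDerivation F I I where
  toFun x :=
    { toLinearMap := LieModule.toEnd F L I x
      leibniz' := fun y z => by
        have h : ⁅x, ⁅(y : L), (z : L)⁆⁆ = ⁅(y : L), ⁅x, (z : L)⁆⁆ - ⁅(z : L), ⁅x, (y : L)⁆⁆ := by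
          rw [leibniz_lie, ← lie_skew (z : L)]
          abel
        exact Subtype.ext h }
  map_add' x y := LieDerivation.ext fun z => add_lie x y z
  map_smul' t x := LieDerivation.ext fun z => smul_lie t x z

@[simp] theorem coe_adOnIdeal_apply (I : LieIdeal F L) (x : L) (y : I) :
    (adOnIdeal I x y : L) = ⁅x, (y : L)⁆ := rfl

/-- The bracket of a Lie algebra, with values in an ideal that contains the derived algebra. -/
def lieInto (I : LieIdeal F L) (hI : ∀ x y : L, ⁅x, y⁆ ∈ I) : L →ₗ[F] L →ₗ[F] I :=
  LinearMap.mk₂ F (fun x y => ⟨⁅x, y⁆, hI x y⟩)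
    (fun _ _ _ => Subtype.ext (add_lie _ _ _)) (fun _ _ _ => Subtype.ext (smul_lie _ _ _))
    (fun _ _ _ => Subtype.ext (lie_add _ _ _)) (fun _ _ _ => Subtype.ext (lie_smul _ _ _))

@[simp] theorem coe_lieInto_apply (I : LieIdeal F L) (hI : ∀ x y : L, ⁅x, y⁆ ∈ I) (x y : L) :
    (lieInto I hI x y : L) = ⁅x, y⁆ := rfl

end InvariantMetric

section OrthogonalRetraction

variable {F V E : Type*} [Field F] [AddCommGroup V] [Module F V] [FiniteDimensional F V]
  [AddCommGroup E] [Module F E] {B : LinearMap.BilinForm F E} {ι : V →ₗ[F] E}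

/-- The retraction `ρ` of `ι` for which `ι ∘ ρ` is the projection onto the image of `ι` along its
orthogonal complement, for a form `B` that is non-degenerate on that image. -/
noncomputable def orthogonalRetraction (hV : (B.comp ι ι).Nondegenerate) : E →ₗ[F] V :=
  (LinearMap.BilinForm.toDual _ hV).symm.toLinearMap ∘ₗ B.compl₂ ι

theorem apply_orthogonalRetraction (hV : (B.comp ι ι).Nondegenerate) (x : E) (v : V) :
    B (ι (orthogonalRetraction hV x)) (ι v) = B x (ι v) :=
  LinearMap.BilinForm.apply_toDual_symm_apply (hB := hV) (B.compl₂ ι x) v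

theorem orthogonalRetraction_eq_iff (hV : (B.comp ι ι).Nondegenerate) {x : E} {w : V} :
    orthogonalRetraction hV x = w ↔ ∀ v, B x (ι v) = B (ι w) (ι v) := by
  refine ⟨fun h v => by rw [← h, apply_orthogonalRetraction], fun h => ?_⟩
  refine sub_eq_zero.1 (hV.1 _ fun v => ?_)
  rw [LinearMap.BilinForm.comp_apply, map_sub, map_sub, LinearMap.sub_apply,
    apply_orthogonalRetraction, h, sub_self]

theorem orthogonalRetraction_apply (hV : (B.comp ι ι).Nondegenerate) (v : V) :
    orthogonalRetraction hV (ι v) = v :=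
  (orthogonalRetraction_eq_iff hV).2 fun _ => rfl

end OrthogonalRetraction

section Split

variable {F 𝔤 V 𝔊 : Type*} [Field F] [LieRing 𝔤] [LieAlgebra F 𝔤] [LieRing V] [LieAlgebra F V]
  [LieRing 𝔊] [LieAlgebra F 𝔊] {ι : V →ₗ⁅F⁆ 𝔊} {π : 𝔊 →ₗ⁅F⁆ 𝔤} {B : LinearMap.BilinForm F 𝔊}

/-- The splitting of an extension of Lie algebras defined by a retraction of its kernel. -/
noncomputable def prodEquivOfRetraction (hext : LieAlgebra.IsExtension ι π) (ρ : 𝔊 →ₗ⁅F⁆ V)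
    (hρ : ∀ v, ρ (ι v) = v) : 𝔊 ≃ₗ⁅F⁆ 𝔤 × V :=
  LieEquiv.ofBijective (π.prod ρ) <| by
    constructor
    · refine (injective_iff_map_eq_zero _).2 fun X hX => ?_
      obtain ⟨hπX, hρX⟩ : π X = 0 ∧ ρ X = 0 := Prod.ext_iff.1 hX
      obtain ⟨v, rfl⟩ := ((ι.range_eq_ker_iff π).1 hext.exact X).1 hπX
      rw [← hρ v, hρX, map_zero]
    · rintro ⟨p, v⟩
      obtain ⟨X, rfl⟩ := π.range_eq_top.1 hext.range_eq_top p
      refine ⟨X - ι (ρ X) + ι v, Prod.ext ?_ ?_⟩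
      · have hπι (w : V) : π (ι w) = 0 := hext.extension.proj_incl w
        simp [hπι]
      · simp [hρ]

/-- The retraction onto a central subspace along its orthogonal complement, as a homomorphism of
Lie algebras. -/
noncomputable def orthogonalRetractionHom [IsLieAbelian V] [FiniteDimensional F V]
    (hB : IsInvariantMetric B) (hcentral : ∀ v, ι v ∈ LieAlgebra.center F 𝔊)
    (hV : (B.comp (ι : V →ₗ[F] 𝔊) (ι : V →ₗ[F] 𝔊)).Nondegenerate) : 𝔊 →ₗ⁅F⁆ V where
  __ := orthogonalRetraction hV
  map_lie' {X Y} := by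
    refine ((orthogonalRetraction_eq_iff hV).2 fun v => ?_).trans
      (trivial_lie_zero V V _ _).symm
    rw [hB.symm, LieHom.coe_toLinearMap, hB.apply_lie_eq_zero_of_mem_center (hcentral v),
      map_zero, map_zero, LinearMap.zero_apply]

theorem exists_isometry_prod_of_nondegenerate [IsLieAbelian V] [FiniteDimensional F V]
    (hext : LieAlgebra.IsExtension ι π) (hcentral : ∀ v, ι v ∈ LieAlgebra.center F 𝔊)
    (hB : IsInvariantMetric B)
    (hV : (B.comp (ι : V →ₗ[F] 𝔊) (ι : V →ₗ[F] 𝔊)).Nondegenerate) :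
    ∃ B' : LinearMap.BilinForm F 𝔤, IsInvariantMetric B' ∧ ∃ ψ : 𝔊 ≃ₗ⁅F⁆ 𝔤 × V,
      ∀ X Y, B X Y = B' (ψ X).1 (ψ Y).1 + B (ι (ψ X).2) (ι (ψ Y).2) := by
  have hρ : ∀ v, orthogonalRetractionHom hB hcentral hV (ι v) = v := orthogonalRetraction_apply hV
  let ψ := prodEquivOfRetraction hext _ hρ
  let σ : 𝔤 →ₗ⁅F⁆ 𝔊 := (ψ.symm : 𝔤 × V →ₗ⁅F⁆ 𝔊).comp (LieHom.inl F 𝔤 V)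
  have hψι (v : V) : ψ (ι v) = (0, v) := Prod.ext (hext.extension.proj_incl v) (hρ v)
  have hψσ (p : 𝔤) : ψ (σ p) = (p, 0) := ψ.apply_symm_apply (p, 0)
  have decomp (X : 𝔊) : X = σ (ψ X).1 + ι (ψ X).2 :=
    EquivLike.injective ψ <| by rw [map_add, hψσ, hψι, Prod.mk_add_mk, add_zero, zero_add]
  have orthogonal (p : 𝔤) (v : V) : B (σ p) (ι v) = 0 := by
    have hρσ : orthogonalRetraction hV (σ p) = 0 := congrArg Prod.snd (hψσ p)
    simpa using (orthogonalRetraction_eq_iff hV).1 hρσ v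
  refine ⟨B.comp (σ : 𝔤 →ₗ[F] 𝔊) (σ : 𝔤 →ₗ[F] 𝔊), hB.comp_of_apply_lie _
    (fun x y z => congrArg (B (σ x)) (σ.map_lie y z)) (fun p hp => ?_), ψ, fun X Y => ?_⟩
  · have hσp : σ p = 0 := hB.eq_zero_of_forall_apply_eq_zero fun Y => by
      rw [decomp Y, map_add, orthogonal, add_zero]
      exact hp _
    simpa [hσp, eq_comm] using congrArg Prod.fst (hψσ p)
  · conv_lhs => rw [decomp X, decomp Y]
    simp [orthogonal, hB.symm (ι _) (σ _)]

end Split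

section CentralExtension

variable {F 𝔤 V 𝔊 : Type*} [Field F] [LieRing 𝔤] [LieAlgebra F 𝔤] [LieRing V] [LieAlgebra F V]
  [LieRing 𝔊] [LieAlgebra F 𝔊]

/-- The pairing of `V` with a subspace `𝔞` of `𝔤` induced by a form on `𝔊` and a linear map
`s : 𝔤 → 𝔊`, which will be a section of the projection. -/
def sectionPairing (B : LinearMap.BilinForm F 𝔊) (ι : V →ₗ⁅F⁆ 𝔊) (s : 𝔤 →ₗ[F] 𝔊)
    (𝔞 : Submodule F 𝔤) : V →ₗ[F] Dual F 𝔞 :=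
  B.compl₁₂ (ι : V →ₗ[F] 𝔊) (s ∘ₗ 𝔞.subtype)

/-- The trilinear form `(a, b, c) ↦ B ⁅s a, s b⁆ (s c)` on `𝔞`. It will be the component `ω` of the
bracket of the double central extension. -/
def sectionCocycle (B : LinearMap.BilinForm F 𝔊) (s : 𝔤 →ₗ[F] 𝔊) (𝔞 : Submodule F 𝔤) :
    𝔞 →ₗ[F] 𝔞 →ₗ[F] Dual F 𝔞 :=
  LinearMap.mk₂ F (fun a b => B ⁅s a, s b⁆ ∘ₗ s ∘ₗ 𝔞.subtype)
    (fun _ _ _ => by ext; simp) (fun _ _ _ => by ext; simp)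
    (fun _ _ _ => by ext; simp) (fun _ _ _ => by ext; simp)

theorem sectionCocycle_apply (B : LinearMap.BilinForm F 𝔊) (s : 𝔤 →ₗ[F] 𝔊) {𝔞 : Submodule F 𝔤}
    (a b c : 𝔞) : sectionCocycle B s 𝔞 a b c = B ⁅s a, s b⁆ (s c) := rfl

/-- A central extension `0 → V → 𝔊 → 𝔤 → 0` of Lie algebras with an invariant metric on `𝔊` for
which `V` is isotropic. -/
structure IsIsotropicCentralExtension (ι : V →ₗ⁅F⁆ 𝔊) (π : 𝔊 →ₗ⁅F⁆ 𝔤)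
    (B : LinearMap.BilinForm F 𝔊) : Prop where
  isExtension : LieAlgebra.IsExtension ι π
  central : ∀ v, ι v ∈ LieAlgebra.center F 𝔊
  metric : IsInvariantMetric B
  isotropic : ∀ u v, B (ι u) (ι v) = 0

namespace IsIsotropicCentralExtension

variable {ι : V →ₗ⁅F⁆ 𝔊} {π : 𝔊 →ₗ⁅F⁆ 𝔤} {B : LinearMap.BilinForm F 𝔊}

theorem proj_incl (h : IsIsotropicCentralExtension ι π B) (v : V) : π (ι v) = 0 :=
  h.isExtension.extension.proj_incl v

theorem incl_injective (h : IsIsotropicCentralExtension ι π B) : Function.Injective ι :=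
  ι.ker_eq_bot.1 h.isExtension.ker_eq_bot

theorem proj_surjective (h : IsIsotropicCentralExtension ι π B) : Function.Surjective π :=
  π.range_eq_top.1 h.isExtension.range_eq_top

theorem exists_linear_section (h : IsIsotropicCentralExtension ι π B) :
    ∃ s : 𝔤 →ₗ[F] 𝔊, ∀ p, π (s p) = p := by
  obtain ⟨s, hs⟩ := (π : 𝔊 →ₗ[F] 𝔤).exists_rightInverse_of_surjective
    (LinearMap.range_eq_top.2 h.proj_surjective)
  exact ⟨s, LinearMap.congr_fun hs⟩

theorem exists_eq_add_incl (h : IsIsotropicCentralExtension ι π B) {X Y : 𝔊}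
    (hXY : π X = π Y) : ∃ v, X = Y + ι v := by
  obtain ⟨v, hv⟩ := ((ι.range_eq_ker_iff π).1 h.isExtension.exact (X - Y)).1
    (by rw [map_sub, hXY, sub_self])
  exact ⟨v, by rw [hv, add_sub_cancel]⟩

theorem lie_incl (h : IsIsotropicCentralExtension ι π B) (X : 𝔊) (v : V) : ⁅X, ι v⁆ = 0 :=
  (LieModule.mem_maxTrivSubmodule F 𝔊 𝔊 (ι v)).1 (h.central v) X

theorem lie_congr (h : IsIsotropicCentralExtension ι π B) {X X' Y Y' : 𝔊} (hX : π X = π X')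
    (hY : π Y = π Y') : ⁅X, Y⁆ = ⁅X', Y'⁆ := by
  obtain ⟨v, rfl⟩ := h.exists_eq_add_incl hX
  obtain ⟨w, rfl⟩ := h.exists_eq_add_incl hY
  rw [lie_add, h.lie_incl, add_zero, add_lie, ← lie_skew (ι v), h.lie_incl, neg_zero, add_zero]

theorem apply_incl_congr (h : IsIsotropicCentralExtension ι π B) (v : V) {X Y : 𝔊}
    (hXY : π X = π Y) : B (ι v) X = B (ι v) Y := by
  obtain ⟨w, rfl⟩ := h.exists_eq_add_incl hXY
  rw [map_add, h.isotropic, add_zero]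

theorem apply_incl_lie (h : IsIsotropicCentralExtension ι π B) (v : V) (X Y : 𝔊) :
    B (ι v) ⁅X, Y⁆ = 0 :=
  h.metric.apply_lie_eq_zero_of_mem_center (h.central v) X Y

/-- The image in `𝔤` of the orthogonal complement of `V`. It is an ideal because that complement
contains every bracket. -/
def orthogonalIdeal (h : IsIsotropicCentralExtension ι π B) : LieIdeal F 𝔤 where
  __ := (B.orthogonal (LinearMap.range (ι : V →ₗ[F] 𝔊))).map (π : 𝔊 →ₗ[F] 𝔤)
  lie_mem := by
    rintro q _ ⟨X, -, rfl⟩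
    obtain ⟨Y, rfl⟩ := h.proj_surjective q
    refine ⟨⁅Y, X⁆, ?_, π.map_lie Y X⟩
    rintro _ ⟨v, rfl⟩
    exact h.apply_incl_lie v Y X

theorem proj_mem_orthogonalIdeal_iff (h : IsIsotropicCentralExtension ι π B) {X : 𝔊} :
    π X ∈ h.orthogonalIdeal ↔ ∀ v, B (ι v) X = 0 := by
  constructor
  · rintro ⟨Y, hY, hYX⟩ v
    rw [h.apply_incl_congr v hYX.symm]
    exact hY _ ⟨v, rfl⟩
  · refine fun hX => ⟨X, ?_, rfl⟩
    rintro _ ⟨v, rfl⟩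
    exact hX v

theorem lie_mem_orthogonalIdeal (h : IsIsotropicCentralExtension ι π B) (p q : 𝔤) :
    ⁅p, q⁆ ∈ h.orthogonalIdeal := by
  obtain ⟨X, rfl⟩ := h.proj_surjective p
  obtain ⟨Y, rfl⟩ := h.proj_surjective q
  rw [← LieHom.map_lie]
  exact h.proj_mem_orthogonalIdeal_iff.2 fun v => h.apply_incl_lie v X Y

theorem apply_congr (h : IsIsotropicCentralExtension ι π B) {X X' Y Y' : 𝔊}
    (hX : π X ∈ h.orthogonalIdeal) (hY : π Y ∈ h.orthogonalIdeal)
    (hXX' : π X = π X') (hYY' : π Y = π Y') : B X Y = B X' Y' := by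
  rw [hXX', h.proj_mem_orthogonalIdeal_iff] at hX
  rw [h.proj_mem_orthogonalIdeal_iff] at hY
  obtain ⟨v, rfl⟩ := h.exists_eq_add_incl hXX'
  obtain ⟨w, rfl⟩ := h.exists_eq_add_incl hYY'
  rw [map_add B, LinearMap.add_apply, hY, add_zero, map_add, h.metric.symm X' (ι w), hX, add_zero]

theorem isPerfPair_sectionPairing [FiniteDimensional F V] (h : IsIsotropicCentralExtension ι π B)
    {s : 𝔤 →ₗ[F] 𝔊} (hs : ∀ p, π (s p) = p) {𝔞 : Submodule F 𝔤}
    (h𝔞 : IsCompl 𝔞 h.orthogonalIdeal.toSubmodule) : (sectionPairing B ι s 𝔞).IsPerfPair := by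
  refine .of_injective ((injective_iff_map_eq_zero _).2 fun v hv => ?_)
    ((injective_iff_map_eq_zero _).2 fun a ha => ?_)
  · refine (map_eq_zero_iff ι h.incl_injective).1 ?_
    refine h.metric.eq_zero_of_forall_apply_eq_zero fun X => ?_
    obtain ⟨a, x, hax⟩ := Submodule.existsUnique_add_of_isCompl h𝔞 (π X)
    have hva : B (ι v) (s a) = 0 := LinearMap.congr_fun hv a
    have hvx : B (ι v) (s x) = 0 := h.proj_mem_orthogonalIdeal_iff.1 ((hs x).symm ▸ x.2) v
    rw [h.apply_incl_congr v (hs (π X)).symm, ← hax.1, map_add, map_add, hva, hvx, add_zero]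
  · have ha' : π (s a) ∈ h.orthogonalIdeal :=
      h.proj_mem_orthogonalIdeal_iff.2 fun v => LinearMap.congr_fun ha v
    rw [hs] at ha'
    exact Subtype.ext (Submodule.disjoint_def.1 h𝔞.disjoint a a.2 ha')

/-- A linear section `s` of the projection, together with a complement `𝔞` of the orthogonal ideal
`𝔥`, for which `s 𝔞` is isotropic and orthogonal to `s 𝔥`, that is, orthogonal to `s 𝔤`. -/
structure IsIsotropicSection (h : IsIsotropicCentralExtension ι π B) (𝔞 : Submodule F 𝔤)
    (s : 𝔤 →ₗ[F] 𝔊) : Prop where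
  isCompl : IsCompl 𝔞 h.orthogonalIdeal.toSubmodule
  section_apply : ∀ p, π (s p) = p
  apply_eq_zero : ∀ (a : 𝔞) (p : 𝔤), B (s a) (s p) = 0

theorem exists_isIsotropicSection [NeZero (2 : F)] [FiniteDimensional F V]
    (h : IsIsotropicCentralExtension ι π B) {𝔞 : Submodule F 𝔤}
    (h𝔞 : IsCompl 𝔞 h.orthogonalIdeal.toSubmodule) : ∃ s, h.IsIsotropicSection 𝔞 s := by
  obtain ⟨s, hs⟩ := h.exists_linear_section
  have := h.isPerfPair_sectionPairing hs h𝔞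
  -- Replacing `s` by `s + ι ∘ t`, where `B (ι (t p)) (s a) = τ p a`, adds `τ p a + τ a (P p)` to
  -- `B (s a) (s p)`. For the `τ` below this sum is `-B (s a) (s p)`.
  let P : 𝔤 →ₗ[F] 𝔤 := 𝔞.projection _ h𝔞
  let τ : 𝔤 →ₗ[F] Dual F 𝔞 :=
    B.compl₁₂ (s ∘ₗ ((2⁻¹ : F) • P - LinearMap.id)) (s ∘ₗ 𝔞.subtype)
  let t : 𝔤 →ₗ[F] V := (sectionPairing B ι s 𝔞).toPerfPair.symm.toLinearMap ∘ₗ τ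
  have ht (p : 𝔤) (a : 𝔞) : B (ι (t p)) (s a) = 2⁻¹ * B (s (P p)) (s a) - B (s p) (s a) := by
    have htτ : B (ι (t p)) (s a) = τ p a :=
      LinearMap.congr_fun ((sectionPairing B ι s 𝔞).toPerfPair.apply_symm_apply (τ p)) a
    rw [htτ]
    simp [τ]
  refine ⟨s + (ι : V →ₗ[F] 𝔊) ∘ₗ t, h𝔞, fun p => ?_, fun a p => ?_⟩
  · simp [hs, h.proj_incl]
  · have hp : π (s (p - P p)) ∈ h.orthogonalIdeal :=
      (hs (p - P p)).symm ▸ Submodule.sub_projection_mem h𝔞 p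
    have hta : B (ι (t a)) (s p) = B (ι (t a)) (s (P p)) := by
      rw [← sub_eq_zero, ← map_sub, ← map_sub, h.proj_mem_orthogonalIdeal_iff.1 hp]
    have hta' : B (ι (t a)) (s (P p)) = 2⁻¹ * B (s a) (s (P p)) - B (s a) (s (P p)) := by
      rw [ht a ⟨P p, Submodule.projection_apply_mem h𝔞 p⟩, Submodule.projection_apply_left h𝔞 a]
    simp only [LinearMap.add_apply, LinearMap.comp_apply, LieHom.coe_toLinearMap, map_add,
      h.isotropic, h.metric.symm (s a) (ι _), ht, hta, hta', h.metric.symm (s (P p)) (s a),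
      h.metric.symm (s p) (s a)]
    linear_combination B (s a) (s (P p)) * inv_mul_cancel₀ (two_ne_zero' F)

/-- The form on the orthogonal ideal induced by `B` and a linear section `s` of the projection. -/
def idealForm (h : IsIsotropicCentralExtension ι π B) (s : 𝔤 →ₗ[F] 𝔊) :
    LinearMap.BilinForm F h.orthogonalIdeal :=
  B.comp (s ∘ₗ h.orthogonalIdeal.toSubmodule.subtype) (s ∘ₗ h.orthogonalIdeal.toSubmodule.subtype)

theorem idealForm_eq_apply (h : IsIsotropicCentralExtension ι π B) {s : 𝔤 →ₗ[F] 𝔊}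
    (hs : ∀ p, π (s p) = p) {x y : h.orthogonalIdeal} {X Y : 𝔊} (hX : π X = x) (hY : π Y = y) :
    h.idealForm s x y = B X Y :=
  h.apply_congr ((hs x).symm ▸ x.2) ((hs y).symm ▸ y.2) ((hs x).trans hX.symm)
    ((hs y).trans hY.symm)

namespace IsIsotropicSection

variable {h : IsIsotropicCentralExtension ι π B} {𝔞 : Submodule F 𝔤} {s : 𝔤 →ₗ[F] 𝔊}

theorem exists_eq_add_add (H : h.IsIsotropicSection 𝔞 s) (X : 𝔊) :
    ∃ (a : 𝔞) (x : h.orthogonalIdeal) (v : V), X = s a + s x + ι v := by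
  obtain ⟨a, x, hax, -⟩ := Submodule.existsUnique_add_of_isCompl H.isCompl (π X)
  obtain ⟨v, hv⟩ := h.exists_eq_add_incl (H.section_apply (π X)).symm
  exact ⟨a, x, v, by rw [hv, ← map_add, hax]⟩

theorem apply_incl_section (H : h.IsIsotropicSection 𝔞 s) (v : V) (x : h.orthogonalIdeal) :
    B (ι v) (s x) = 0 :=
  h.proj_mem_orthogonalIdeal_iff.1 ((H.section_apply x).symm ▸ x.2) v

theorem apply_add_add (H : h.IsIsotropicSection 𝔞 s) (a b : 𝔞) (x y : h.orthogonalIdeal)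
    (v w : V) : B (s a + s x + ι v) (s b + s y + ι w) =
      h.idealForm s x y + B (ι w) (s a) + B (ι v) (s b) := by
  have hxy : h.idealForm s x y = B (s x) (s y) := rfl
  simp only [map_add, LinearMap.add_apply, h.metric.symm (s _) (ι _), h.metric.symm (s x) (s b),
    H.apply_eq_zero, H.apply_incl_section, h.isotropic, hxy]
  ring

theorem isInvariantMetric_idealForm (H : h.IsIsotropicSection 𝔞 s) :
    IsInvariantMetric (h.idealForm s) := by
  refine h.metric.comp_of_apply_lie _ (fun x y z => ?_) (fun x hx => ?_)
  · have hlie : π ⁅s y, s z⁆ = (⁅y, z⁆ : h.orthogonalIdeal) := by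
      simp [H.section_apply]
    exact h.idealForm_eq_apply H.section_apply (H.section_apply x) hlie
  · have hsx : s x = 0 := h.metric.eq_zero_of_forall_apply_eq_zero fun Y => by
      obtain ⟨b, y, w, rfl⟩ := H.exists_eq_add_add Y
      have hxY := H.apply_add_add 0 b x y 0 w
      rw [show h.idealForm s x y = 0 from hx y] at hxY
      simpa only [ZeroMemClass.coe_zero, map_zero, zero_add, add_zero, LinearMap.zero_apply]
        using hxY
    exact Subtype.ext (by rw [← H.section_apply x, hsx, map_zero, ZeroMemClass.coe_zero])

theorem idealForm_adOnIdeal (H : h.IsIsotropicSection 𝔞 s) (p : 𝔤) (x y : h.orthogonalIdeal) :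
    h.idealForm s (adOnIdeal _ p x) y = B ⁅s p, s x⁆ (s y) :=
  h.idealForm_eq_apply H.section_apply (by simp [H.section_apply]) (H.section_apply y)

theorem idealForm_lieInto (H : h.IsIsotropicSection 𝔞 s) (p q : 𝔤) (y : h.orthogonalIdeal) {Y : 𝔊}
    (hY : π Y = y) :
    h.idealForm s (lieInto _ h.lie_mem_orthogonalIdeal p q) y = B ⁅s p, s q⁆ Y :=
  h.idealForm_eq_apply H.section_apply (by simp [H.section_apply]) hY

theorem idealForm_lieInto_lieInto (H : h.IsIsotropicSection 𝔞 s) (p q q' d : 𝔤) :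
    h.idealForm s (lieInto _ h.lie_mem_orthogonalIdeal p d)
      (lieInto _ h.lie_mem_orthogonalIdeal q q') = -B (s d) ⁅s p, ⁅s q, s q'⁆⁆ := by
  rw [H.idealForm_lieInto p d _ (Y := ⁅s q, s q'⁆) (by simp [H.section_apply]),
    h.metric.invariant (s d), ← lie_skew (s d), map_neg, LinearMap.neg_apply, neg_neg]

/-- The data of the double central extension to which `𝔊` is isometric. -/
def data (H : h.IsIsotropicSection 𝔞 s) :
    DoubleCentralData F 𝔞 H.isInvariantMetric_idealForm where
  φ := adOnIdeal h.orthogonalIdeal ∘ₗ 𝔞.subtype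
  Ψ := (lieInto _ h.lie_mem_orthogonalIdeal).compl₁₂ 𝔞.subtype 𝔞.subtype
  ω := sectionCocycle B s 𝔞
  phi_skew a x y := by
    rw [H.isInvariantMetric_idealForm.symm x]
    refine (H.idealForm_adOnIdeal a x y).trans ?_
    refine .trans ?_ (congrArg _ (H.idealForm_adOnIdeal a y x).symm)
    rw [← lie_skew, map_neg, LinearMap.neg_apply, ← h.metric.invariant, h.metric.symm]
  psi_alt a := Subtype.ext (lie_self (a : 𝔤))
  phi_comm a b x := Subtype.ext (lie_lie (a : 𝔤) (b : 𝔤) (x : 𝔤)).symm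
  phi_cyclic a b c := Subtype.ext (lie_jacobi (a : 𝔤) (b : 𝔤) (c : 𝔤))
  chi_cyclic a b c d := by
    simp only [LinearMap.compl₁₂_apply, Submodule.subtype_apply, H.idealForm_lieInto_lieInto,
      neg_neg, ← map_add, lie_jacobi, map_zero]
  omega_alt a := by ext c; simp [sectionCocycle_apply]
  omega_cyclic a b c := by
    rw [sectionCocycle_apply, sectionCocycle_apply, ← h.metric.invariant, h.metric.symm]

theorem coe_data_φ (H : h.IsIsotropicSection 𝔞 s) (a : 𝔞) (x : h.orthogonalIdeal) :
    (H.data.φ a x : 𝔤) = ⁅(a : 𝔤), (x : 𝔤)⁆ := rfl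

theorem coe_data_Ψ (H : h.IsIsotropicSection 𝔞 s) (a b : 𝔞) :
    (H.data.Ψ a b : 𝔤) = ⁅(a : 𝔤), (b : 𝔤)⁆ := rfl

/-- The identification of `𝔞 ⊕ 𝔥` with `𝔤` as Lie algebras. -/
noncomputable def baseEquiv (H : h.IsIsotropicSection 𝔞 s) : H.data.Base ≃ₗ⁅F⁆ 𝔤 where
  __ := ((DoubleCentralData.Base.equivProd (D := H.data)).linearEquiv F).trans
    (Submodule.prodEquivOfIsCompl 𝔞 _ H.isCompl : (𝔞 × h.orthogonalIdeal) ≃ₗ[F] 𝔤)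
  map_lie' {p q} := by
    change (0 : 𝔤) + (⁅p.x, q.x⁆ + H.data.φ p.a q.x - H.data.φ q.a p.x + H.data.Ψ p.a q.a :
      h.orthogonalIdeal) = ⁅(p.a : 𝔤) + (p.x : 𝔤), (q.a : 𝔤) + (q.x : 𝔤)⁆
    simp only [LieSubmodule.coe_add, LieSubmodule.coe_sub, coe_data_φ, coe_data_Ψ,
      LieSubmodule.coe_bracket, LieIdeal.coe_bracket_of_module, add_lie, lie_add,
      ← lie_skew (q.a : 𝔤) (p.x : 𝔤)]
    abel

theorem baseEquiv_apply (H : h.IsIsotropicSection 𝔞 s) (p : H.data.Base) :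
    H.baseEquiv p = (p.a : 𝔤) + (p.x : 𝔤) := rfl

theorem apply_lie_section (H : h.IsIsotropicSection 𝔞 s) (p q : H.data.Base) (c : 𝔞) :
    B ⁅s (H.baseEquiv p), s (H.baseEquiv q)⁆ (s c) =
      (H.data.Phi p.x q.x + H.data.chi p.a q.x - H.data.chi q.a p.x + H.data.ω p.a q.a) c := by
  have hΦ (x y : h.orthogonalIdeal) : H.data.Phi x y c = B ⁅s x, s y⁆ (s c) := by
    rw [h.metric.symm, h.metric.invariant]
    exact H.idealForm_adOnIdeal c x y
  have hχ (a : 𝔞) (y : h.orthogonalIdeal) : H.data.chi a y c = B ⁅s a, s y⁆ (s c) := by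
    rw [h.metric.symm, h.metric.invariant, ← lie_skew, map_neg, LinearMap.neg_apply]
    exact congrArg _ (H.idealForm_lieInto a c y (H.section_apply y))
  have hω (a b : 𝔞) : H.data.ω a b c = B ⁅s a, s b⁆ (s c) := rfl
  simp only [LinearMap.add_apply, LinearMap.sub_apply, hΦ, hχ, hω, baseEquiv_apply, map_add,
    add_lie, lie_add, ← lie_skew (s p.x) (s q.a), map_neg, LinearMap.neg_apply]
  ring

theorem finrank_complement [FiniteDimensional F V] (H : h.IsIsotropicSection 𝔞 s) :
    finrank F 𝔞 = finrank F V := by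
  have := h.isPerfPair_sectionPairing H.section_apply H.isCompl
  exact (Module.finrank_of_isPerfPair (sectionPairing B ι s 𝔞)).symm

theorem finrank_orthogonalIdeal_add [FiniteDimensional F V] [FiniteDimensional F 𝔤]
    (H : h.IsIsotropicSection 𝔞 s) :
    finrank F h.orthogonalIdeal + finrank F V = finrank F 𝔤 := by
  rw [← H.finrank_complement, add_comm]
  exact Submodule.finrank_add_eq_of_isCompl H.isCompl

theorem finrank_le_finrank_center [FiniteDimensional F V] [FiniteDimensional F 𝔤]
    (H : h.IsIsotropicSection 𝔞 s) {Bg : LinearMap.BilinForm F 𝔤} (hBg : IsInvariantMetric Bg) :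
    finrank F V ≤ finrank F (LieAlgebra.center F 𝔤) := by
  refine Nat.le_of_add_le_add_left (H.finrank_orthogonalIdeal_add.trans_le ?_)
  exact hBg.finrank_le_finrank_add_finrank_center h.lie_mem_orthogonalIdeal

variable [CharZero F]

/-- The projection to `𝔤 = 𝔞 ⊕ 𝔥`, together with the functional that an element of `𝔊` defines on
`𝔞` through `B` and `s`. -/
noncomputable def toTotal (H : h.IsIsotropicSection 𝔞 s) : 𝔊 →ₗ⁅F⁆ H.data.Total where
  toFun X := ⟨(H.baseEquiv.symm (π X)).a, (H.baseEquiv.symm (π X)).x, B X ∘ₗ s ∘ₗ 𝔞.subtype⟩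
  map_add' X Y := by
    ext1
    · simp
    · simp
    · ext; simp
  map_smul' t X := by
    ext1
    · simp
    · simp
    · ext; simp
  map_lie' {X Y} := by
    have hlie : ⁅X, Y⁆ = ⁅s (H.baseEquiv (H.baseEquiv.symm (π X))),
        s (H.baseEquiv (H.baseEquiv.symm (π Y)))⁆ :=
      h.lie_congr (by simp [H.section_apply]) (by simp [H.section_apply])
    have hbase := H.baseEquiv.symm.map_lie (π X) (π Y)
    rw [← LieHom.map_lie] at hbase
    ext1
    · exact congrArg DoubleCentralData.Base.a hbase
    · exact congrArg DoubleCentralData.Base.x hbase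
    · ext c
      exact (congrArg (fun Z => B Z (s c)) hlie).trans (H.apply_lie_section _ _ c)

theorem baseEquiv_proj_toTotal (H : h.IsIsotropicSection 𝔞 s) (X : 𝔊) :
    H.baseEquiv (DoubleCentralData.Total.proj (H.toTotal X)) = π X :=
  H.baseEquiv.apply_symm_apply (π X)

theorem toTotal_add_add (H : h.IsIsotropicSection 𝔞 s) (a : 𝔞) (x : h.orthogonalIdeal) (v : V) :
    H.toTotal (s a + s x + ι v) = ⟨a, x, sectionPairing B ι s 𝔞 v⟩ := by
  have hbase : DoubleCentralData.Total.proj (H.toTotal (s a + s x + ι v)) = ⟨a, x⟩ := by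
    refine EquivLike.injective H.baseEquiv ?_
    rw [H.baseEquiv_proj_toTotal]
    simp [H.section_apply, h.proj_incl, baseEquiv_apply]
  ext1
  · exact congrArg DoubleCentralData.Base.a hbase
  · exact congrArg DoubleCentralData.Base.x hbase
  · ext c
    have hX := H.apply_add_add a c x 0 v 0
    simp only [ZeroMemClass.coe_zero, map_zero, zero_add, add_zero, LinearMap.zero_apply] at hX
    exact hX

theorem toTotal_incl (H : h.IsIsotropicSection 𝔞 s) (v : V) :
    H.toTotal (ι v) = ⟨0, 0, sectionPairing B ι s 𝔞 v⟩ := by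
  simpa using H.toTotal_add_add 0 0 v

theorem metric_toTotal (H : h.IsIsotropicSection 𝔞 s) (X Y : 𝔊) :
    DoubleCentralData.Total.metric (H.toTotal X) (H.toTotal Y) = B X Y := by
  obtain ⟨a, x, v, rfl⟩ := H.exists_eq_add_add X
  obtain ⟨b, y, w, rfl⟩ := H.exists_eq_add_add Y
  rw [H.toTotal_add_add, H.toTotal_add_add, H.apply_add_add]
  rfl

theorem toTotal_bijective [FiniteDimensional F V] (H : h.IsIsotropicSection 𝔞 s) :
    Function.Bijective H.toTotal := by
  constructor
  · refine (injective_iff_map_eq_zero _).2 fun X hX =>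
      h.metric.eq_zero_of_forall_apply_eq_zero fun Y => ?_
    rw [← H.metric_toTotal, hX, map_zero, LinearMap.zero_apply]
  · rintro ⟨a, x, α⟩
    have := h.isPerfPair_sectionPairing H.section_apply H.isCompl
    obtain ⟨v, rfl⟩ := (sectionPairing B ι s 𝔞).toPerfPair.surjective α
    exact ⟨s a + s x + ι v, H.toTotal_add_add a x v⟩

end IsIsotropicSection

end IsIsotropicCentralExtension

end CentralExtension

theorem mainTheorem1_general {F 𝔤 V 𝔊 : Type*} [Field F] [CharZero F]
    [LieRing 𝔤] [LieAlgebra F 𝔤] [LieRing V] [LieAlgebra F V] [IsLieAbelian V]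
    [FiniteDimensional F V] [LieRing 𝔊] [LieAlgebra F 𝔊]
    (Bg : LinearMap.BilinForm F 𝔤) (hBg : IsInvariantMetric Bg)
    (ι : V →ₗ⁅F⁆ 𝔊) (π : 𝔊 →ₗ⁅F⁆ 𝔤) (hext : LieAlgebra.IsExtension ι π)
    (hcentral : ∀ v, ι v ∈ LieAlgebra.center F 𝔊)
    (BG : LinearMap.BilinForm F 𝔊) (hBG : IsInvariantMetric BG) :
    ((BG.comp (ι : V →ₗ[F] 𝔊) (ι : V →ₗ[F] 𝔊)).Nondegenerate →
      ∃ Bg' : LinearMap.BilinForm F 𝔤, IsInvariantMetric Bg' ∧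
        ∃ ψ : 𝔊 ≃ₗ⁅F⁆ 𝔤 × V, ∀ X Y : 𝔊,
          BG X Y = Bg' (ψ X).1 (ψ Y).1 + BG (ι (ψ X).2) (ι (ψ Y).2)) ∧
    ((∀ u v : V, BG (ι u) (ι v) = 0) →
      (FiniteDimensional F 𝔤 → finrank F V ≤ finrank F (LieAlgebra.center F 𝔤)) ∧
      ∃ (𝔞 : Submodule F 𝔤) (𝔥 : LieIdeal F 𝔤),
        IsCompl 𝔞 𝔥.toSubmodule ∧ finrank F 𝔞 = finrank F V ∧
        (FiniteDimensional F 𝔤 → finrank F 𝔥 + finrank F V = finrank F 𝔤) ∧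
        (∀ x y : 𝔤, ⁅x, y⁆ ∈ 𝔥) ∧
        ∃ (Bh : LinearMap.BilinForm F 𝔥) (hBh : IsInvariantMetric Bh)
          (D : DoubleCentralData F 𝔞 hBh)
          (Ω : 𝔊 ≃ₗ⁅F⁆ D.Total) (ξ : V ≃ₗ[F] Dual F 𝔞)
          (e : D.Base ≃ₗ⁅F⁆ 𝔤) (Bah : LinearMap.BilinForm F D.Base),
          (∀ X Y, BG X Y = DoubleCentralData.Total.metric (Ω X) (Ω Y)) ∧
          (∀ v, Ω (ι v) = ⟨0, 0, ξ v⟩) ∧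
          IsInvariantMetric Bah ∧
          (∀ p, e p = (p.a : 𝔤) + (p.x : 𝔤)) ∧
          (∀ p q, Bah p q = Bg (e p) (e q)) ∧
          (∀ X, e (DoubleCentralData.Total.proj (Ω X)) = π X)) := by
  refine ⟨exists_isometry_prod_of_nondegenerate hext hcentral hBG, fun hiso => ?_⟩
  have h : IsIsotropicCentralExtension ι π BG := ⟨hext, hcentral, hBG, hiso⟩
  obtain ⟨𝔞, h𝔞⟩ := h.orthogonalIdeal.toSubmodule.exists_isCompl
  obtain ⟨s, H⟩ := h.exists_isIsotropicSection h𝔞.symm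
  have := h.isPerfPair_sectionPairing H.section_apply H.isCompl
  refine ⟨fun _ => H.finrank_le_finrank_center hBg, 𝔞, h.orthogonalIdeal, H.isCompl,
    H.finrank_complement, fun _ => H.finrank_orthogonalIdeal_add, h.lie_mem_orthogonalIdeal,
    h.idealForm s, H.isInvariantMetric_idealForm, H.data,
    LieEquiv.ofBijective H.toTotal H.toTotal_bijective, (sectionPairing BG ι s 𝔞).toPerfPair,
    H.baseEquiv, Bg.comp _ _, fun X Y => (H.metric_toTotal X Y).symm, H.toTotal_incl,
    hBg.comp_lieEquiv H.baseEquiv, H.baseEquiv_apply, fun _ _ => rfl, H.baseEquiv_proj_toTotal⟩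

theorem mainTheorem1 {F 𝔤 V 𝔊 : Type*} [Field F] [IsAlgClosed F] [CharZero F]
    [LieRing 𝔤] [LieAlgebra F 𝔤] [FiniteDimensional F 𝔤]
    [LieRing V] [LieAlgebra F V] [IsLieAbelian V] [FiniteDimensional F V]
    [LieRing 𝔊] [LieAlgebra F 𝔊]
    (n r : ℕ) (hn : finrank F 𝔤 = n) (hr : finrank F V = r)
    (Bg : LinearMap.BilinForm F 𝔤) (hBg : IsInvariantMetric Bg)
    (ι : V →ₗ⁅F⁆ 𝔊) (π : 𝔊 →ₗ⁅F⁆ 𝔤) (hext : LieAlgebra.IsExtension ι π)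
    (hcentral : ∀ v, ι v ∈ LieAlgebra.center F 𝔊)
    (BG : LinearMap.BilinForm F 𝔊) (hBG : IsInvariantMetric BG) :
    -- `V` non-degenerate
    ((BG.comp (ι : V →ₗ[F] 𝔊) (ι : V →ₗ[F] 𝔊)).Nondegenerate →
      ∃ Bg' : LinearMap.BilinForm F 𝔤, IsInvariantMetric Bg' ∧
        ∃ ψ : 𝔊 ≃ₗ⁅F⁆ 𝔤 × V, ∀ X Y : 𝔊,
          BG X Y = Bg' (ψ X).1 (ψ Y).1 + BG (ι (ψ X).2) (ι (ψ Y).2)) ∧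
    -- `V` isotropic
    ((∀ u v : V, BG (ι u) (ι v) = 0) →
      r ≤ finrank F (LieAlgebra.center F 𝔤) ∧
      ∃ (𝔞 : Submodule F 𝔤) (𝔥 : LieIdeal F 𝔤),
        IsCompl 𝔞 𝔥.toSubmodule ∧ finrank F 𝔞 = r ∧ finrank F 𝔥 + r = n ∧
        (∀ x y : 𝔤, ⁅x, y⁆ ∈ 𝔥) ∧
        ∃ (Bh : LinearMap.BilinForm F 𝔥) (hBh : IsInvariantMetric Bh)
          (D : DoubleCentralData F 𝔞 hBh)
          (Ω : 𝔊 ≃ₗ⁅F⁆ D.Total) (ξ : V ≃ₗ[F] Dual F 𝔞)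
          (e : D.Base ≃ₗ⁅F⁆ 𝔤) (Bah : LinearMap.BilinForm F D.Base),
          -- `𝔊` is isometric to the double central extension `𝔞 ⊕ 𝔥 ⊕ 𝔞*`, and `V ≅ 𝔞*`
          (∀ X Y, BG X Y = DoubleCentralData.Total.metric (Ω X) (Ω Y)) ∧
          (∀ v, Ω (ι v) = ⟨0, 0, ξ v⟩) ∧
          -- `𝔤 = 𝔞 ⊕ 𝔥` as quadratic Lie algebras, compatibly with the projections
          IsInvariantMetric Bah ∧
          (∀ p, e p = (p.a : 𝔤) + (p.x : 𝔤)) ∧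
          (∀ p q, Bah p q = Bg (e p) (e q)) ∧
          (∀ X, e (DoubleCentralData.Total.proj (Ω X)) = π X)) := by
  subst hn hr
  simpa only [‹FiniteDimensional F 𝔤›, true_imp_iff] using
    mainTheorem1_general Bg hBg ι π hext hcentral BG hBG
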